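/- Let $\mathbb K$ be a field of characteristic zero. Let $H_R$ be the Hopf algebra of (non-planar) rooted trees: the free commutative $\mathbb K$-algebra on rooted trees, with grafting operator $B_+$ (which joins all trees of a forest to a new root) and with the multiplicative coproduct determined by $\Delta\circ B_+ = B_+\otimes 1+(\mathrm{id}\otimes B_+)\circ\Delta$. Let $\mathbb K[\ell]$ be the Hopf algebra of polynomials with $\Delta \ell=\ell\otimes 1+1\otimes \ell$. A one-cocycle on a bialgebra $H$ is a linear map $L:H\to H$ with $\Delta\circ L=(\mathrm{id}\otimes L)\circ\Delta+L\otimes 1$. For a power series $f$ in $g$ with constant coefficient $1$ and $p\in\mathbb K$, put $f^p=\sum_{n\ge0}\binom pn (f-1)^n$. Let $\kappa\in\mathbb K$ and let $B_1,B_2,\dots$ be one-cocycles on $H_R$. Then the combinatorial Dyson–Schwinger equation $$X(g)=1+\sum_{n\ge1}g^nB_n\big(X(g)^{1+n\kappa}\big)$$ has a unique solution $X(g)=\sum_n x_ng^n\in H_R[[g]]$. Let $\varphi:H_R\to\mathbb K[\ell]$ be any morphism of bialgebras, let $G(g)=\sum_n\varphi(x_n)g^n\in\mathbb K[\ell][[g]]$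 be the correlation function, let $G_a(g)\in\mathbb K[[g]]$ be its value at $\ell=a$, put $\varphi_a=\mathrm{ev}_a\circ\varphi$, and let $\widetilde\gamma(g)=-\partial_\ell|_{\ell=0}G(g)\in\mathbb K[[g]]$ be the physical anomalous dimension. Then for all $a,b\in\mathbb K$ $$G_{a+b}(g)=(\varphi_a\star\varphi_b)\circ X(g)=G_a(g)\cdot G_b\big(g\,G_a(g)^\kappa\big)=G_b(g)\cdot G_a\big(g\,G_b(g)^\kappa\big),$$ where $\star$ is the convolution product, and in $\mathbb K[\ell][[g]]$ $$G(g)\cdot\widetilde\gamma\big(g\,G(g)^\kappa\big)=-\partial_\ell G(g)=\widetilde\gamma(g)\cdot(1+\kappa g\,\partial_g)G(g).$$ This applies to the renormalized Feynman rules with Mellin transform $F(z)=c_{-1}z^{-1}+\sum_{n\ge0}c_nz^n$: for all $c_{-1},c_0,c_1,\dots\in\mathbb K$ there is exactly one morphism of algebras $\varphi:H_R\to\mathbb K[\ell]$ with $\varphi\circ B_+=L\circ\varphi$, and it is a morphism of bialgebras. Here $L=-c_{-1}\int_0+\big((\mathrm{id}\otimes\eta)\circ\Delta-\eta(\cdot)1\big)$,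 where $\int_0\ell^n=\ell^{n+1}/(n+1)$ and $\eta(\ell^n)=n!\,(-1)^nc_n$. -/

import Mathlib

open scoped TensorProduct

namespace DysonSchwinger

noncomputable section

/-! ### Non-planar rooted trees -/

/-- Planar rooted trees: `leaf` is the one-vertex tree and `graft a b` is the tree obtained from `b`
by attaching the root of `a` as a further child of the root of `b`. -/
inductive PlanarTree : Type
  | leaf : PlanarTree
  | graft : PlanarTree → PlanarTree → PlanarTree

/-- Isomorphism of rooted trees (the order of the children of each vertex is forgotten): the
congruence generated by exchanging two consecutive children. -/
inductive PlanarTree.Iso : PlanarTree → PlanarTree → Prop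
  | refl (a : PlanarTree) : Iso a a
  | symm {a b : PlanarTree} : Iso a b → Iso b a
  | trans {a b c : PlanarTree} : Iso a b → Iso b c → Iso a c
  | congr {a a' b b' : PlanarTree} : Iso a a' → Iso b b' → Iso (.graft a b) (.graft a' b')
  | swap (a b c : PlanarTree) : Iso (.graft a (.graft b c)) (.graft b (.graft a c))

instance PlanarTree.setoid : Setoid PlanarTree :=
  ⟨PlanarTree.Iso, ⟨.refl, .symm, .trans⟩⟩

/-- (Non-planar, unordered) rooted trees, up to isomorphism. -/
def RTree : Type := Quotient PlanarTree.setoid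

namespace RTree

/-- The isomorphism class of a planar tree. -/
def mk (a : PlanarTree) : RTree := Quotient.mk _ a

/-- The tree with a single vertex. -/
def leaf : RTree := mk .leaf

/-- `graft a b` attaches the root of `a` as a further child of the root of `b`. -/
def graft : RTree → RTree → RTree :=
  Quotient.map₂ PlanarTree.graft fun _ _ h _ _ h' => .congr h h'

theorem graft_left_comm (a b c : RTree) : graft a (graft b c) = graft b (graft a c) := by
  induction a, b, c using Quotient.inductionOn₃
  exact Quotient.sound (.swap _ _ _)

instance : LeftCommutative graft := ⟨graft_left_comm⟩

/-- The tree whose root has the given multiset (forest) of trees as its branches. -/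
def node (s : Multiset RTree) : RTree := s.foldr graft leaf

@[simp] theorem node_zero : node 0 = leaf := rfl

@[simp] theorem node_cons (t : RTree) (s : Multiset RTree) : node (t ::ₘ s) = graft t (node s) := by
  simp [node]

@[elab_as_elim]
theorem induction {P : RTree → Prop} (t : RTree) (hl : P leaf)
    (hg : ∀ a b, P a → P b → P (graft a b)) : P t := by
  induction t using Quotient.inductionOn with
  | h p =>
    induction p with
    | leaf => exact hl
    | graft a b iha ihb => exact hg _ _ iha ihb

theorem exists_node (t : RTree) : ∃ s, node s = t := by
  induction t using RTree.induction with
  | hl => exact ⟨0, rfl⟩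
  | hg a b _ ihb =>
    obtain ⟨s, rfl⟩ := ihb
    exact ⟨a ::ₘ s, by simp⟩

end RTree

/-! ### The Hopf algebra of rooted trees -/

/-- The free commutative algebra on the rooted trees. Its monomials are the rooted forests. (This is a
new type, as it gets a coproduct of its own.) -/
def HR (K : Type*) [Field K] : Type _ := MvPolynomial RTree K

section HR

variable (K : Type*) [Field K]

instance : CommRing (HR K) := inferInstanceAs (CommRing (MvPolynomial RTree K))

instance : Algebra K (HR K) := inferInstanceAs (Algebra K (MvPolynomial RTree K))

/-- The identification with the polynomial algebra. -/
def equivMvPolynomial : HR K ≃ₐ[K] MvPolynomial RTree K := AlgEquiv.refl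

/-- A tree as an element of `HR K`. -/
def tree (t : RTree) : HR K := (equivMvPolynomial K).symm (MvPolynomial.X t)

/-- The linear basis of forests. -/
def forestBasis : Module.Basis (RTree →₀ ℕ) K (HR K) :=
  (MvPolynomial.basisMonomials RTree K).map (equivMvPolynomial K).symm.toLinearEquiv

/-- The algebra morphism with prescribed values on trees. -/
def liftTrees {A : Type*} [CommSemiring A] [Algebra K A] (f : RTree → A) : HR K →ₐ[K] A :=
  (MvPolynomial.aeval f).comp (equivMvPolynomial K).toAlgHom

@[simp] theorem liftTrees_tree {A : Type*} [CommSemiring A] [Algebra K A] (f : RTree → A) (t : RTree) :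
    liftTrees K f (tree K t) = f t := by
  simp [liftTrees, tree]

/-- The grafting operator: the linear map which sends a forest to the tree obtained by attaching
all its components to a new root. -/
def Bplus : HR K →ₗ[K] HR K :=
  (forestBasis K).constr K fun s => tree K (RTree.node (Finsupp.toMultiset s))

/-- The forest of the branches of the root, as a monomial. -/
def branches (s : Multiset RTree) : HR K := (s.map (tree K)).prod

theorem branches_toMultiset (s : RTree →₀ ℕ) :
    branches K (Finsupp.toMultiset s) = forestBasis K s := by
  have h : forestBasis K s = (equivMvPolynomial K).symm (MvPolynomial.monomial s 1) := by
    simp [forestBasis]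
  have h' : branches K (Finsupp.toMultiset s) = (equivMvPolynomial K).symm
      ((Finsupp.toMultiset s).map MvPolynomial.X).prod := by
    rw [map_multiset_prod, Multiset.map_map]
    rfl
  rw [h, h', MvPolynomial.monomial_eq, Finsupp.toMultiset_map, Finsupp.prod_toMultiset]
  simp [Finsupp.prod_mapDomain_index, pow_add]

/-- `B₊` sends the forest with components `s` to the tree with branches `s`. -/
theorem Bplus_branches (s : Multiset RTree) :
    Bplus K (branches K s) = tree K (RTree.node s) := by
  classical
  obtain ⟨s, rfl⟩ : ∃ u, Finsupp.toMultiset u = s := ⟨_, Multiset.toFinsupp_toMultiset s⟩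
  rw [branches_toMultiset, Bplus, Module.Basis.constr_basis]

/-- Two linear maps on `HR K` agree if they agree on forests. -/
theorem linearMap_ext {M : Type*} [AddCommMonoid M] [Module K M] {f g : HR K →ₗ[K] M}
    (h : ∀ s, f (branches K s) = g (branches K s)) : f = g := by
  refine (forestBasis K).ext fun s => ?_
  rw [← branches_toMultiset]
  exact h _

/-- The coproduct of the forest of branches of the root of a planar tree, by recursion: the
coproduct is multiplicative, and `Δ ∘ B₊ = B₊ ⊗ 1 + (id ⊗ B₊) ∘ Δ` on each branch. -/
def comulPlanar : PlanarTree → HR K ⊗[K] HR K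
  | .leaf => 1
  | .graft a b =>
      (tree K (RTree.mk a) ⊗ₜ[K] 1 + (Bplus K).lTensor (HR K) (comulPlanar a))
        * comulPlanar b

/-- `comulPlanar` on isomorphism classes. -/
def comulBranches : RTree → HR K ⊗[K] HR K :=
  Quotient.lift (comulPlanar K) (by
    intro a b h
    change PlanarTree.Iso a b at h
    induction h with
    | refl a => rfl
    | symm _ ih => exact ih.symm
    | trans _ _ ih ih' => exact ih.trans ih'
    | @congr a a' b b' h h' ih ih' =>
      have : (RTree.mk a) = RTree.mk a' := Quotient.sound h
      simp only [comulPlanar, ih, ih', this]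
    | swap a b c => simp only [comulPlanar]; ring)

/-- The coproduct of `HR K`: the algebra morphism with `Δ ∘ B₊ = B₊ ⊗ 1 + (id ⊗ B₊) ∘ Δ`
(see `comul_Bplus`). -/
def comulHR : HR K →ₐ[K] HR K ⊗[K] HR K :=
  liftTrees K fun t =>
    tree K t ⊗ₜ[K] 1 + (Bplus K).lTensor (HR K) (comulBranches K t)

/-- The counit: `1` on the empty forest and `0` on all other forests. -/
def counitHR : HR K →ₐ[K] K := liftTrees K fun _ => 0

theorem comul_X (t : RTree) : comulHR K (tree K t) =
    tree K t ⊗ₜ[K] 1 + (Bplus K).lTensor (HR K) (comulBranches K t) := by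
  simp [comulHR]

theorem comulBranches_graft (a b : RTree) : comulBranches K (RTree.graft a b) =
    comulHR K (tree K a) * comulBranches K b := by
  rw [comul_X]
  induction a, b using Quotient.inductionOn₂
  rfl

theorem comulBranches_node (s : Multiset RTree) :
    comulBranches K (RTree.node s) = comulHR K (branches K s) := by
  induction s using Multiset.induction with
  | empty => simp [branches]; rfl
  | cons a s ih =>
    rw [RTree.node_cons, comulBranches_graft, ih, ← map_mul]
    simp [branches]

/-- The defining property of the coproduct. -/
theorem comul_Bplus (f : HR K) :
    comulHR K (Bplus K f) = Bplus K f ⊗ₜ[K] 1 + (Bplus K).lTensor (HR K) (comulHR K f) := by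
  have : (comulHR K).toLinearMap ∘ₗ Bplus K =
      ((TensorProduct.mk K (HR K) (HR K)).flip 1) ∘ₗ Bplus K
        + (Bplus K).lTensor (HR K) ∘ₗ (comulHR K).toLinearMap := by
    refine linearMap_ext K fun s => ?_
    simp [Bplus_branches, comul_X, comulBranches_node]
  exact congr($this f)

theorem counit_Bplus (f : HR K) : counitHR K (Bplus K f) = 0 := by
  have : (counitHR K).toLinearMap ∘ₗ Bplus K = 0 := by
    refine linearMap_ext K fun s => ?_
    simp [Bplus_branches, counitHR]
  exact congr($this f)

/-- Two algebra morphisms on `HR K` agree if agreement at `f` implies agreement at `B₊ f`. -/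
theorem algHom_ext_Bplus {A : Type*} [Semiring A] [Algebra K A] {f g : HR K →ₐ[K] A}
    (h : ∀ x, f x = g x → f (Bplus K x) = g (Bplus K x)) : f = g := by
  have key : ∀ t : RTree, ∃ s, RTree.node s = t ∧ f (branches K s) = g (branches K s) := by
    intro t
    induction t using RTree.induction with
    | hl => exact ⟨0, rfl, by simp [branches]⟩
    | hg a b iha ihb =>
      obtain ⟨s, rfl, hs⟩ := iha
      obtain ⟨u, rfl, hu⟩ := ihb
      refine ⟨RTree.node s ::ₘ u, by simp, ?_⟩
      have e : branches K (RTree.node s ::ₘ u) = Bplus K (branches K s) * branches K u := by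
        rw [Bplus_branches]; simp [branches]
      rw [e, map_mul, map_mul, hu, h _ hs]
  have e : f.toLinearMap = g.toLinearMap := by
    refine linearMap_ext K fun s => ?_
    induction s using Multiset.induction with
    | empty => simp [branches]
    | cons t s ih =>
      obtain ⟨u, rfl, hu⟩ := key t
      have e : branches K (RTree.node u ::ₘ s) = Bplus K (branches K u) * branches K s := by
        rw [Bplus_branches]; simp [branches]
      simp only [AlgHom.toLinearMap_apply] at ih ⊢
      rw [e, map_mul, map_mul, ih, h _ hu]
  exact AlgHom.toLinearMap_injective e

/-- The bialgebra of rooted trees. -/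
instance instBialgebraHR : Bialgebra K (HR K) :=
  Bialgebra.ofAlgHom (comulHR K) (counitHR K)
    (by
      apply algHom_ext_Bplus
      intro x hx
      have h1 : ∀ y : HR K ⊗[K] HR K,
          Algebra.TensorProduct.assoc K K K (HR K) (HR K) (HR K)
            (Algebra.TensorProduct.map (comulHR K) (.id K (HR K)) ((Bplus K).lTensor (HR K) y)) =
          ((Bplus K).lTensor (HR K)).lTensor (HR K)
            (Algebra.TensorProduct.assoc K K K (HR K) (HR K) (HR K)
              (Algebra.TensorProduct.map (comulHR K) (.id K (HR K)) y)) := by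
        intro y
        induction y using TensorProduct.induction_on with
        | zero => simp
        | add a b ha hb => simp only [map_add, ha, hb]
        | tmul a b =>
          simp only [LinearMap.lTensor_tmul, Algebra.TensorProduct.map_tmul, AlgHom.id_apply]
          induction comulHR K a using TensorProduct.induction_on with
          | zero => simp
          | add c d hc hd => simp only [TensorProduct.add_tmul, map_add, hc, hd]
          | tmul c d => simp
      have h2 : ∀ y : HR K ⊗[K] HR K,
          Algebra.TensorProduct.map (.id K (HR K)) (comulHR K) ((Bplus K).lTensor (HR K) y) =
          Algebra.TensorProduct.assoc K K K (HR K) (HR K) (HR K)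
            ((Bplus K).lTensor (HR K) y ⊗ₜ[K] 1) +
          ((Bplus K).lTensor (HR K)).lTensor (HR K)
            (Algebra.TensorProduct.map (.id K (HR K)) (comulHR K) y) := by
        intro y
        induction y using TensorProduct.induction_on with
        | zero => simp
        | add a b ha hb => simp only [map_add, TensorProduct.add_tmul, ha, hb]; abel
        | tmul a b => simp [comul_Bplus, TensorProduct.tmul_add]
      simp only [AlgHom.comp_apply, AlgEquiv.coe_toAlgHom] at hx ⊢
      rw [comul_Bplus, map_add, map_add, map_add, h1, h2, hx]
      simp [comul_Bplus, TensorProduct.add_tmul, Algebra.TensorProduct.one_def, add_assoc])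
    (by
      apply algHom_ext_Bplus
      intro x hx
      have h1 : ∀ y : HR K ⊗[K] HR K,
          Algebra.TensorProduct.map (counitHR K) (.id K (HR K)) ((Bplus K).lTensor (HR K) y) =
          (Bplus K).lTensor K (Algebra.TensorProduct.map (counitHR K) (.id K (HR K)) y) := by
        intro y
        induction y using TensorProduct.induction_on with
        | zero => simp
        | add a b ha hb => simp only [map_add, ha, hb]
        | tmul a b => simp
      simp only [AlgHom.comp_apply] at hx ⊢
      rw [comul_Bplus, map_add, h1, hx]
      simp [counit_Bplus])
    (by
      apply algHom_ext_Bplus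
      intro x hx
      have h1 : ∀ y : HR K ⊗[K] HR K,
          Algebra.TensorProduct.map (.id K (HR K)) (counitHR K) ((Bplus K).lTensor (HR K) y) =
          0 := by
        intro y
        induction y using TensorProduct.induction_on with
        | zero => simp
        | add a b ha hb => simp only [map_add, ha, hb, add_zero]
        | tmul a b => simp [counit_Bplus]
      simp only [AlgHom.comp_apply] at hx ⊢
      rw [comul_Bplus, map_add, h1]
      simp)

end HR

/-! ### The Hopf algebra of polynomials -/

section Polynomials

open Polynomial

variable (K : Type*) [Field K]

/-- The bialgebra of polynomials, in which the variable is primitive: `Δ x = x ⊗ 1 + 1 ⊗ x` and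
`ε p = p(0)`. -/
instance instBialgebraPolynomial : Bialgebra K K[X] :=
  Bialgebra.ofAlgHom (aeval (X ⊗ₜ[K] 1 + 1 ⊗ₜ[K] X)) (aeval 0)
    (by ext; simp [TensorProduct.tmul_add, TensorProduct.add_tmul, Algebra.TensorProduct.one_def, add_assoc])
    (by ext; simp)
    (by ext; simp)

/-- The integration operator `xⁿ ↦ xⁿ⁺¹ / (n+1)`. -/
def integration : K[X] →ₗ[K] K[X] :=
  (basisMonomials K).constr K fun n => monomial (n + 1) (((n : K) + 1)⁻¹)

end Polynomials

/-! ### Hochschild one-cocycles -/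

section Cocycles

variable {K H : Type*} [Field K] [CommRing H] [Bialgebra K H]

/-- One-cocycles: `Δ ∘ L = (id ⊗ L) ∘ Δ + L ⊗ 1`. -/
def IsOneCocycle (L : H →ₗ[K] H) : Prop :=
  ∀ x : H, Coalgebra.comul (R := K) (L x) =
    L.lTensor H (Coalgebra.comul (R := K) x) + L x ⊗ₜ[K] 1

/-- The coboundary `(id ⊗ α) ∘ Δ - α(·) 1` of a functional `α`. -/
def coboundary (α : H →ₗ[K] K) : H →ₗ[K] H :=
  (TensorProduct.rid K H).toLinearMap ∘ₗ α.lTensor H ∘ₗ Coalgebra.comul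
    - Algebra.linearMap K H ∘ₗ α

/-- The convolution product of functionals, `φ ⋆ ψ = m ∘ (φ ⊗ ψ) ∘ Δ`. -/
def convolution (φ ψ : H →ₗ[K] K) : H →ₗ[K] K :=
  LinearMap.mul' K K ∘ₗ TensorProduct.map φ ψ ∘ₗ Coalgebra.comul

end Cocycles

/-- The cocycle `-c₋₁ ∫ + dη` with `η(xⁿ) = n! (-1)ⁿ cₙ`, attached to the coefficients of a
Mellin transform `F(z) = c₋₁ z⁻¹ + ∑_{n ≥ 0} cₙ zⁿ`. -/
def mellinCocycle {K : Type*} [Field K] (cres : K) (c : ℕ → K) :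
    Polynomial K →ₗ[K] Polynomial K :=
  -cres • integration K + coboundary ((Polynomial.basisMonomials K).constr K fun n =>
    (n.factorial : K) * (-1) ^ n * c n)

/-! ### Power series and Dyson-Schwinger equations -/

section Series

variable {K A A' : Type*} [Field K] [CharZero K] [CommRing A] [Algebra K A]
  [CommRing A'] [Algebra K A']

/-- The power `f ^ p = ∑ₙ (p choose n) (f - 1)ⁿ` with `p` in the ground field, for power series `f`
with constant coefficient `1`. -/
def genPow (f : PowerSeries A) (p : K) : PowerSeries A :=
  (PowerSeries.binomialSeries A p).subst (f - 1)

/-- Apply a linear map to all coefficients of a power series. -/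
def mapCoeff (φ : A →ₗ[K] A') (f : PowerSeries A) : PowerSeries A' :=
  PowerSeries.mk fun n => φ (PowerSeries.coeff n f)

/-- `X` solves the combinatorial Dyson-Schwinger equation
`X(g) = 1 + ∑_{n ≥ 1} gⁿ Bₙ(X(g)^(1 + n κ))`, compared coefficientwise in `g`. -/
def IsDSESolution (κ : K) (B : ℕ → A →ₗ[K] A) (X : PowerSeries A) : Prop :=
  X = 1 + PowerSeries.mk fun m => ∑ n ∈ Finset.Icc 1 m,
    B n (PowerSeries.coeff (m - n) (genPow X (1 + (n : K) * κ)))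

end Series

/-! ### Correlation functions -/

section Correlation

open Polynomial

variable {K : Type*} [Field K]

/-- `φ_a = ev_a ∘ φ`. -/
def evalAt (φ : HR K →ₐc[K] K[X]) (a : K) : HR K →ₗ[K] K :=
  leval a ∘ₗ (φ : HR K →ₗ[K] K[X])

/-- The correlation function `G(g) = φ ∘ X(g)`, a power series in `g` with coefficients in `K[ℓ]`. -/
def correlation (φ : HR K →ₐc[K] K[X]) (S : PowerSeries (HR K)) : PowerSeries K[X] :=
  mapCoeff (φ : HR K →ₗ[K] K[X]) S

/-- The specialization `G_a(g)` of the correlation function at `ℓ = a`. -/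
def correlationAt (φ : HR K →ₐc[K] K[X]) (S : PowerSeries (HR K)) (a : K) : PowerSeries K :=
  mapCoeff (leval a) (correlation φ S)

/-- The anomalous dimension `γ = -∂₀ ∘ φ`, where `∂₀ p = p'(0)`. -/
def anomalousDim (φ : HR K →ₐc[K] K[X]) : HR K →ₗ[K] K :=
  -(leval 0 ∘ₗ derivative ∘ₗ (φ : HR K →ₗ[K] K[X]))

/-- The physical anomalous dimension `γ̃(g) = γ ∘ X(g)`. -/
def physicalAnomalousDim (φ : HR K →ₐc[K] K[X]) (S : PowerSeries (HR K)) : PowerSeries K :=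
  mapCoeff (anomalousDim φ) S

end Correlation

end

end DysonSchwinger

/-! Everything follows from one formula for the coproduct of the solution. Put `X₁ = X ⊗ 1`, `X₂ = 1
⊗ X`. Applying `Δ` to the Dyson–Schwinger equation, the cocycle property gives `Y = X₁ + ∑ gⁿ (id ⊗
Bₙ)(Y^(1+nκ))` for `Y = ΔX`. Such an equation determines `Y` order by order in `g`
(`existsUnique_dseMap`). The series `X₁ · X₂(g X₁^κ)` solves it too: `gⁿ X₁^(1+nκ) = X₁ (g X₁^κ)ⁿ`,
and `id ⊗ Bₙ` is linear over the left tensor factor. Hence `ΔX = X₁ · X₂(g X₁^κ)` (`map_comul_eq`),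
i.e. `Δ xₘ = ∑ₙ [g^(m-n)] X^(1+nκ) ⊗ xₙ` (`comul_coeff_eq`).

On `K[ℓ]` translation is convolution, `ev_(a+b) = ev_a ⋆ ev_b`, and differentiation is convolution
with `∂₀` on either side; a bialgebra morphism carries both to `HR K`. Applying `φ_a ⊗ φ_b` to the
coproduct formula gives the functional equation. Applying `φ ⊗ γ` gives `G · γ̃(g G^κ)`; applying `γ
⊗ φ` gives `γ̃ · (1 + κ g ∂_g) G`, because `γ` is a derivation along the counit and `ε(X) = 1`, so
that `γ(X^p) = p γ(X)`.

The Feynman rules come from the universal property of `B₊`: every linear `L` induces a unique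
algebra morphism, compatible with the coproducts and counits when `L` is a cocycle. Integration and
coboundaries are cocycles. -/

namespace DysonSchwinger

/-! ### Powers of power series with exponents in the ground field -/

section PowerSeriesPowers

open PowerSeries

theorem constantCoeff_map_eq_one {K A A' : Type*} [Field K] [CommRing A] [Algebra K A]
    [CommRing A'] [Algebra K A'] (φ : A →ₐ[K] A') {f : PowerSeries A}
    (hf : constantCoeff f = 1) : constantCoeff (PowerSeries.map (φ : A →+* A') f) = 1 := by
  rw [← coeff_zero_eq_constantCoeff_apply, coeff_map, coeff_zero_eq_constantCoeff_apply, hf,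
    map_one]

variable {K A A' : Type*} [Field K] [CharZero K] [CommRing A] [Algebra K A]
  [CommRing A'] [Algebra K A']

/-- Torsion-freeness is what makes a power series determined by its derivative and its constant
coefficient. -/
theorem isAddTorsionFree_of_algebra (K A : Type*) [Field K] [CharZero K] [CommRing A]
    [Algebra K A] : IsAddTorsionFree A where
  nsmul_right_injective n hn a b h := by
    have h' : (n : K) • a = (n : K) • b := by simpa [Nat.cast_smul_eq_nsmul] using h
    have hn' : (n : K) ≠ 0 := by exact_mod_cast hn
    simpa [smul_smul, hn'] using congr((n : K)⁻¹ • $h')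

theorem hasSubst_sub_one {f : PowerSeries A} (hf : constantCoeff f = 1) : HasSubst (f - 1) :=
  HasSubst.of_constantCoeff_zero' (by simp [hf])

theorem hasSubst_X_mul (f : PowerSeries A) : HasSubst (X * f : PowerSeries A) :=
  HasSubst.of_constantCoeff_zero' (by simp)

/-- Compare consecutive descending Pochhammer polynomials and cancel `n!`. This is the coefficient
form of the differential equation of `(1 + x)^p`. -/
theorem choose_succ_mul (p : K) (n : ℕ) :
    Ring.choose p (n + 1) * (n + 1) + n * Ring.choose p n = p * Ring.choose p n := by
  have h1 := Ring.descPochhammer_eq_factorial_smul_choose p (n + 1)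
  have h2 := Ring.descPochhammer_eq_factorial_smul_choose p n
  rw [descPochhammer_succ_right, Polynomial.smeval_mul, h2] at h1
  have h3 : ((n.factorial : ℕ) : K) ≠ 0 := by exact_mod_cast n.factorial_ne_zero
  simp [Polynomial.smeval_sub, Polynomial.smeval_natCast, nsmul_eq_mul, Nat.factorial_succ] at h1
  apply mul_left_cancel₀ h3
  linear_combination -h1

theorem derivative_binomialSeries (p : K) :
    (1 + X) * derivative A (binomialSeries A p) = p • binomialSeries A p := by
  ext n
  have h := congr(algebraMap K A $(choose_succ_mul p n))
  rw [add_mul, one_mul, map_add,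
    show coeff n (p • binomialSeries A p) = p • coeff n (binomialSeries A p) from rfl]
  simp only [map_add, map_mul, map_natCast, map_one] at h
  cases n with
  | zero =>
    simp [coeff_derivative, Algebra.smul_def]
  | succ n =>
    simp only [coeff_succ_X_mul, coeff_derivative, binomialSeries_coeff,
      Algebra.smul_def, mul_one]
    rw [← h]
    push_cast
    ring

/-- The sum stops at `n` because `X ^ d` divides `b ^ d`. -/
theorem coeff_subst_eq_sum {f b : PowerSeries A} (hb : constantCoeff b = 0) (n : ℕ) :
    coeff n (f.subst b) = ∑ d ∈ Finset.range (n + 1), coeff d f * coeff n (b ^ d) := by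
  rw [coeff_subst' (HasSubst.of_constantCoeff_zero' hb)]
  refine finsum_eq_sum_of_support_subset _ fun d hd => ?_
  by_contra h
  refine hd ?_
  have h1 : (X : PowerSeries A) ^ d ∣ b ^ d := pow_dvd_pow_of_dvd (X_dvd_iff.2 hb) d
  simp only [X_pow_dvd_iff.1 h1 n (by simpa using h), smul_zero]

theorem coeff_genPow {f : PowerSeries A} (hf : constantCoeff f = 1) (p : K) (n : ℕ) :
    coeff n (genPow f p) =
      ∑ d ∈ Finset.range (n + 1), Ring.choose p d • coeff n ((f - 1) ^ d) := by
  rw [genPow, coeff_subst_eq_sum (by simp [hf])]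
  simp

theorem constantCoeff_genPow {f : PowerSeries A} (hf : constantCoeff f = 1) (p : K) :
    constantCoeff (genPow f p) = 1 := by
  rw [← coeff_zero_eq_constantCoeff_apply, coeff_genPow hf]
  simp

/-- Substitute `f - 1` into the differential equation of the binomial series and use the chain rule.
Together with the constant coefficient `1`, this equation characterizes `f ^ p`. -/
theorem mul_derivative_genPow {f : PowerSeries A} (hf : constantCoeff f = 1) (p : K) :
    f * derivative A (genPow f p) = p • (derivative A f * genPow f p) := by
  have hs := hasSubst_sub_one hf
  have h := congr(substAlgHom (S := A) hs $(derivative_binomialSeries (A := A) p))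
  rw [map_mul, map_add, map_one, substAlgHom_X] at h
  simp only [coe_substAlgHom] at h
  rw [genPow, derivative_subst hs]
  have h2 : (p • binomialSeries A p).subst (f - 1) = p • (binomialSeries A p).subst (f - 1) :=
    subst_smul hs p _
  rw [h2, add_sub_cancel] at h
  rw [← mul_assoc, h]
  simp [mul_comm]

/-- A first order linear differential equation has at most one normalized solution. -/
theorem eq_of_mul_derivative_eq (K : Type*) [Field K] [CharZero K] [Algebra K A]
    {f u h₁ h₂ : PowerSeries A} (hf : constantCoeff f = 1)
    (h1 : constantCoeff h₁ = 1) (h2 : constantCoeff h₂ = 1)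
    (e1 : f * derivative A h₁ = u * h₁) (e2 : f * derivative A h₂ = u * h₂) : h₁ = h₂ := by
  have := isAddTorsionFree_of_algebra K A
  obtain ⟨v, hv⟩ := (isUnit_iff_constantCoeff.2 (by simp [h2]) : IsUnit h₂).exists_left_inv
  obtain ⟨w, hw⟩ := (isUnit_iff_constantCoeff.2 (by simp [hf]) : IsUnit f).exists_left_inv
  -- With `v = 1 / h₂`, the aim is that the quotient `h₁ * v` has derivative zero. The product rule
  -- is applied to `h₁ = (h₁ * v) * h₂`, so the inverse need not be differentiated by itself.
  have hd : derivative A h₁ = derivative A (h₁ * v) * h₂ + h₁ * v * derivative A h₂ := by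
    conv_lhs => rw [← mul_one h₁, ← hv, ← mul_assoc]
    rw [Derivation.leibniz]
    simp only [smul_eq_mul]
    ring
  have h0 : derivative A (h₁ * v) = derivative A (1 : PowerSeries A) := by
    have : f * derivative A (h₁ * v) * h₂ = 0 := by
      linear_combination (- f) * hd + e1 - h₁ * v * e2 - u * h₁ * hv
    rw [derivative_one]
    calc _ = (w * f) * (derivative A (h₁ * v)) * (v * h₂) := by rw [hw, hv]; ring
      _ = w * v * (f * derivative A (h₁ * v) * h₂) := by ring
      _ = 0 := by rw [this, mul_zero]
  have h3 : h₁ * v = 1 := derivative.ext h0 (by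
    have := congr(constantCoeff $hv)
    simp only [map_mul, h2, map_one, mul_one] at this
    simp [h1, this])
  calc h₁ = h₁ * v * h₂ := by rw [mul_assoc, hv, mul_one]
    _ = h₂ := by rw [h3, one_mul]

/-- Both sides solve `f h y' = p (f h)' y` with constant coefficient `1`. -/
theorem genPow_mul {f h : PowerSeries A} (hf : constantCoeff f = 1) (hh : constantCoeff h = 1)
    (p : K) : genPow (f * h) p = genPow f p * genPow h p := by
  have hfh : constantCoeff (f * h) = 1 := by simp [hf, hh]
  have e1 := mul_derivative_genPow hf p
  have e2 := mul_derivative_genPow hh p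
  have e3 := mul_derivative_genPow hfh p
  simp only [Algebra.smul_def] at e1 e2 e3
  refine eq_of_mul_derivative_eq K (u := algebraMap K _ p * derivative A (f * h)) hfh
    (constantCoeff_genPow hfh p)
    (by simp [constantCoeff_genPow hf, constantCoeff_genPow hh]) (by rw [e3]; ring) ?_
  simp only [Derivation.leibniz, smul_eq_mul]
  linear_combination h * genPow h p * e1 + f * genPow f p * e2

theorem genPow_add {f : PowerSeries A} (hf : constantCoeff f = 1) (p q : K) :
    genPow f (p + q) = genPow f p * genPow f q := by
  rw [genPow, binomialSeries_add, subst_mul (hasSubst_sub_one hf)]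
  rfl

theorem genPow_natCast {f : PowerSeries A} (hf : constantCoeff f = 1) (n : ℕ) :
    genPow f (n : K) = f ^ n := by
  have hs := hasSubst_sub_one hf
  rw [genPow, binomialSeries_nat, ← coe_substAlgHom hs, map_pow, map_add, map_one, substAlgHom_X,
    add_sub_cancel]

theorem genPow_one {f : PowerSeries A} (hf : constantCoeff f = 1) : genPow f (1 : K) = f := by
  simpa using genPow_natCast (K := K) hf 1

theorem genPow_natCast_mul {f : PowerSeries A} (hf : constantCoeff f = 1) (n : ℕ) (p : K) :
    genPow f (n * p) = genPow f p ^ n := by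
  induction n with
  | zero => simpa using genPow_natCast (K := K) hf 0
  | succ n ih => rw [Nat.cast_succ, add_mul, one_mul, genPow_add hf, ih, pow_succ]

theorem map_genPow (φ : A →ₐ[K] A') {f : PowerSeries A} (hf : constantCoeff f = 1) (p : K) :
    PowerSeries.map (φ : A →+* A') (genPow f p) =
      genPow (PowerSeries.map (φ : A →+* A') f) p := by
  have hm := constantCoeff_map_eq_one φ hf
  ext n
  rw [coeff_map, coeff_genPow hf, coeff_genPow hm, ← map_one (PowerSeries.map (φ : A →+* A')),
    ← map_sub, map_sum]
  refine Finset.sum_congr rfl fun d _ => ?_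
  rw [← map_pow, coeff_map]
  exact map_smul φ _ _

theorem coeff_genPow_map (φ : A →ₐ[K] A') {f : PowerSeries A} (hf : constantCoeff f = 1) (p : K)
    (n : ℕ) : coeff n (genPow (PowerSeries.map (φ : A →+* A') f) p) = φ (coeff n (genPow f p)) := by
  rw [← map_genPow φ hf, coeff_map]
  rfl

/-- If `f` and `h` agree modulo `X ^ m`, so do all powers of `f - 1` and `h - 1`. -/
theorem coeff_genPow_congr {f h : PowerSeries A} (hf : constantCoeff f = 1)
    (hh : constantCoeff h = 1) {m : ℕ} (e : ∀ k < m, coeff k f = coeff k h) (p : K) :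
    ∀ k < m, coeff k (genPow f p) = coeff k (genPow h p) := by
  intro k hk
  rw [coeff_genPow hf, coeff_genPow hh]
  refine Finset.sum_congr rfl fun d _ => ?_
  congr 1
  have h1 : X ^ m ∣ (f - 1) - (h - 1) :=
    X_pow_dvd_iff.2 fun j hj => by simp [e j hj]
  have h2 := X_pow_dvd_iff.1 (h1.trans (sub_dvd_pow_sub_pow _ _ d)) k hk
  rwa [map_sub, sub_eq_zero] at h2

/-- Coefficients of `u^q * f(g u^κ)`. -/
theorem coeff_genPow_mul_subst (f : PowerSeries A) {u : PowerSeries A}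
    (hu : constantCoeff u = 1) (q κ : K) (m : ℕ) :
    coeff m (genPow u q * f.subst (X * genPow u κ)) =
      ∑ n ∈ Finset.range (m + 1), coeff n f * coeff (m - n) (genPow u (q + n * κ)) := by
  rw [coeff_mul]
  have h1 : ∀ x ∈ Finset.HasAntidiagonal.antidiagonal m,
      coeff x.1 (genPow u q) * coeff x.2 (f.subst (X * genPow u κ)) =
      ∑ n ∈ Finset.range (m + 1), coeff n f *
        (coeff x.1 (genPow u q) * coeff x.2 ((X * genPow u κ) ^ n)) := by
    intro x hx
    rw [coeff_subst_eq_sum (by simp), Finset.mul_sum]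
    have := Finset.HasAntidiagonal.mem_antidiagonal.1 hx
    -- The substitution formula only gives `n ≤ x.2`. Extending to `n ≤ m` adds zeros, since `X ^ n`
    -- divides the `n`-th power, and makes the range independent of `x`.
    refine Finset.sum_subset_zero_on_sdiff (by simp; omega) (fun n hn => ?_)
      (fun n _ => by ring)
    simp only [Finset.mem_sdiff, Finset.mem_range] at hn
    rw [mul_pow, coeff_X_pow_mul', if_neg (by omega), mul_zero, mul_zero]
  rw [Finset.sum_congr rfl h1, Finset.sum_comm]
  refine Finset.sum_congr rfl fun n hn => ?_
  -- Here `u^q (X u^κ)ⁿ = Xⁿ u^(q + nκ)`.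
  rw [← Finset.mul_sum, ← coeff_mul, genPow_add hu, genPow_natCast_mul hu, mul_pow,
    mul_left_comm, coeff_X_pow_mul', if_pos (by simpa [Nat.lt_succ_iff] using hn)]

theorem subst_genPow {f h : PowerSeries A} (hf : constantCoeff f = 1) (hh : HasSubst h) (p : K) :
    (genPow f p).subst h = genPow (f.subst h) p := by
  rw [genPow, subst_comp_subst_apply (hasSubst_sub_one hf) hh, genPow, subst_sub hh]
  congr 2
  rw [← coe_substAlgHom hh, map_one]

end PowerSeriesPowers

/-! ### Order-by-order solution of Dyson–Schwinger equations -/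

section FixedPoints

open PowerSeries

variable {K A : Type*} [Field K] [CharZero K] [CommRing A] [Algebra K A]

/-- A map of power series which improves the precision by one order has a unique fixed point. -/
theorem existsUnique_fixedPoint (Φ : PowerSeries A → PowerSeries A)
    (h0 : ∀ f, constantCoeff (Φ f) = 1)
    (hΦ : ∀ m f h, constantCoeff f = 1 → constantCoeff h = 1 →
      (∀ k < m, coeff k f = coeff k h) → ∀ k < m + 1, coeff k (Φ f) = coeff k (Φ h)) :
    ∃! f, f = Φ f := by
  have hc : ∀ i, constantCoeff (Φ^[i] 1) = 1 := by
    intro i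
    cases i with
    | zero => simp
    | succ i => rw [Function.iterate_succ_apply', h0]
  have step : ∀ i, ∀ k < i, coeff k (Φ^[i] 1) = coeff k (Φ^[i + 1] 1) := by
    intro i
    induction i with
    | zero => simp
    | succ i ih =>
      rw [Function.iterate_succ_apply', Function.iterate_succ_apply' Φ (i + 1)]
      exact hΦ i _ _ (hc _) (hc _) ih
  have stable : ∀ i j k, k < i → coeff k (Φ^[i] 1) = coeff k (Φ^[i + j] 1) := by
    intro i j k hk
    induction j with
    | zero => rfl
    | succ j ih => rw [ih, step (i + j) k (by omega)]; rfl
  -- The `i`-th iterate is stable only strictly below order `i`, so coefficient `m` is read off from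
  -- iterate `m + 1`.
  let S : PowerSeries A := mk fun m => coeff m (Φ^[m + 1] 1)
  have hS : ∀ i, ∀ k < i, coeff k S = coeff k (Φ^[i] 1) := by
    intro i k hk
    obtain ⟨j, rfl⟩ := Nat.exists_eq_add_of_le (Nat.succ_le_of_lt hk)
    rw [coeff_mk, stable (k + 1) j k (by omega)]
  have hcS : constantCoeff S = 1 := by
    rw [← coeff_zero_eq_constantCoeff_apply, hS 1 0 one_pos, coeff_zero_eq_constantCoeff_apply, hc]
  refine ⟨S, ?_, fun T hT => ?_⟩
  · ext m
    rw [hΦ m S (Φ^[m] 1) hcS (hc m) (hS m) m (by omega), ← Function.iterate_succ_apply' Φ,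
      hS (m + 1) m (by omega)]
  · have hcT : constantCoeff T = 1 := by rw [hT]; exact h0 T
    have : ∀ i, ∀ k < i, coeff k T = coeff k (Φ^[i] 1) := by
      intro i
      induction i with
      | zero => simp
      | succ i ih =>
        rw [hT, Function.iterate_succ_apply']
        exact hΦ i _ _ hcT (hc i) ih
    ext m
    rw [this (m + 1) m (by omega), hS (m + 1) m (by omega)]

/-- The right hand side of a Dyson-Schwinger equation with inhomogeneous term `C`. -/
noncomputable def dseMap (C : PowerSeries A) (κ : K) (B : ℕ → A →ₗ[K] A) (f : PowerSeries A) :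
    PowerSeries A :=
  C + mk fun m => ∑ n ∈ Finset.Icc 1 m, B n (coeff (m - n) (genPow f (1 + (n : K) * κ)))

theorem coeff_dseMap (C : PowerSeries A) (κ : K) (B : ℕ → A →ₗ[K] A) (f : PowerSeries A) (m : ℕ) :
    coeff m (dseMap C κ B f) = coeff m C +
      ∑ n ∈ Finset.Icc 1 m, B n (coeff (m - n) (genPow f (1 + (n : K) * κ))) := by
  simp [dseMap]

/-- Since `n ≥ 1`, coefficient `k` of the right-hand side sees only coefficients of `f` below `k`.
The inhomogeneous term is general: it is `1` for the equation itself and `X ⊗ 1` for its coproduct.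
-/
theorem existsUnique_dseMap {C : PowerSeries A} (hC : constantCoeff C = 1) (κ : K)
    (B : ℕ → A →ₗ[K] A) : ∃! f, f = dseMap C κ B f := by
  refine existsUnique_fixedPoint _ (fun f => ?_) fun m f h hf hh e k hk => ?_
  · rw [← coeff_zero_eq_constantCoeff_apply, coeff_dseMap]
    simp [hC]
  · rw [coeff_dseMap, coeff_dseMap]
    congr 1
    refine Finset.sum_congr rfl fun n hn => ?_
    rw [Finset.mem_Icc] at hn
    rw [coeff_genPow_congr hf hh e _ (k - n) (by omega)]

theorem isDSESolution_iff {κ : K} {B : ℕ → A →ₗ[K] A} {S : PowerSeries A} :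
    IsDSESolution κ B S ↔ S = dseMap 1 κ B S := Iff.rfl

theorem IsDSESolution.coeff_eq {κ : K} {B : ℕ → A →ₗ[K] A} {S : PowerSeries A}
    (h : IsDSESolution κ B S) (m : ℕ) : coeff m S = coeff m (1 : PowerSeries A) +
      ∑ n ∈ Finset.Icc 1 m, B n (coeff (m - n) (genPow S (1 + (n : K) * κ))) := by
  conv_lhs => rw [isDSESolution_iff.1 h, coeff_dseMap]

theorem IsDSESolution.constantCoeff_eq {κ : K} {B : ℕ → A →ₗ[K] A} {S : PowerSeries A}
    (h : IsDSESolution κ B S) : constantCoeff S = 1 := by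
  rw [← coeff_zero_eq_constantCoeff_apply, h.coeff_eq]
  simp

end FixedPoints

/-! ### The coproduct of the solution -/

section Coproduct

open PowerSeries Algebra.TensorProduct

variable {K H : Type*} [Field K] [CommRing H] [Bialgebra K H]

theorem lTensor_includeLeft_mul (L : H →ₗ[K] H) (a : H) (t : H ⊗[K] H) :
    L.lTensor H ((includeLeft : H →ₐ[K] H ⊗[K] H) a * t) =
      (includeLeft : H →ₐ[K] H ⊗[K] H) a * L.lTensor H t := by
  induction t using TensorProduct.induction_on with
  | zero => simp
  | add x y hx hy => simp only [mul_add, map_add, hx, hy]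
  | tmul x y => simp

/-- Applying `ε ⊗ ε` to the cocycle identity gives `ε(L x) = ε(L x) + ε(L x)`. -/
theorem IsOneCocycle.counit_eq_zero {L : H →ₗ[K] H} (hL : IsOneCocycle L) (x : H) :
    Coalgebra.counit (R := K) (L x) = 0 := by
  have h := congr(TensorProduct.lid K K (TensorProduct.map (Coalgebra.counit (R := K))
    (Coalgebra.counit (R := K)) $(hL x)))
  have h1 : ∀ t : H ⊗[K] H, TensorProduct.lid K K (TensorProduct.map (Coalgebra.counit (R := K))
      (Coalgebra.counit (R := K)) (L.lTensor H t)) = Coalgebra.counit (R := K) (L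
        (TensorProduct.lid K H ((Coalgebra.counit (R := K)).rTensor H t))) := by
    intro t
    induction t using TensorProduct.induction_on with
    | zero => simp
    | add x y hx hy => simp only [map_add, hx, hy]
    | tmul x y => simp
  have h2 : ∀ t : H ⊗[K] H, TensorProduct.lid K K (TensorProduct.map (Coalgebra.counit (R := K))
      (Coalgebra.counit (R := K)) t) = Coalgebra.counit (R := K)
        (TensorProduct.lid K H ((Coalgebra.counit (R := K)).rTensor H t)) := by
    intro t
    induction t using TensorProduct.induction_on with
    | zero => simp
    | add x y hx hy => simp only [map_add, hx, hy]
    | tmul x y => simp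
  rw [h2, map_add, map_add, h1] at h
  simpa using h

variable [CharZero K]

/-- The embedding `x ↦ 1 ⊗ x` intertwines `Bₙ` with `id ⊗ Bₙ`, so `1 ⊗ X` inherits the
Dyson–Schwinger equation. -/
theorem map_includeRight_eq {κ : K} {B : ℕ → H →ₗ[K] H} {S : PowerSeries H}
    (hS : IsDSESolution κ B S) (m : ℕ) :
    (includeRight : H →ₐ[K] H ⊗[K] H) (coeff m S) = coeff m (1 : PowerSeries (H ⊗[K] H)) +
      ∑ n ∈ Finset.Icc 1 m, (B n).lTensor H ((includeRight : H →ₐ[K] H ⊗[K] H)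
        (coeff (m - n) (genPow S (1 + (n : K) * κ)))) := by
  rw [hS.coeff_eq, map_add, map_sum]
  congr 1
  simp only [coeff_one]
  split_ifs <;> simp [one_def]

/-- The terms `Bₙ(⋯) ⊗ 1` of the cocycle identities, together with the constant `1`, add up to `X ⊗
1`; the remaining terms are the equation for `ΔX`, because `Δ` is multiplicative and passes into
powers. -/
theorem map_comul_eq_dseMap {κ : K} {B : ℕ → H →ₗ[K] H} (hB : ∀ n, 1 ≤ n → IsOneCocycle (B n))
    {S : PowerSeries H} (hS : IsDSESolution κ B S) :
    PowerSeries.map (Bialgebra.comulAlgHom K H : H →+* H ⊗[K] H) S =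
      dseMap (PowerSeries.map ((includeLeft : H →ₐ[K] H ⊗[K] H) : H →+* H ⊗[K] H) S) κ
        (fun n => (B n).lTensor H)
        (PowerSeries.map (Bialgebra.comulAlgHom K H : H →+* H ⊗[K] H) S) := by
  ext m
  rw [coeff_dseMap, coeff_map, coeff_map]
  simp only [coeff_genPow_map _ hS.constantCoeff_eq]
  have h : ∀ x, (Bialgebra.comulAlgHom K H : H →+* H ⊗[K] H) x = Coalgebra.comul (R := K) x :=
    fun _ => rfl
  rw [h, hS.coeff_eq, map_add, map_sum]
  simp only [RingHom.coe_coe, includeLeft_apply, Bialgebra.comulAlgHom_apply,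
    TensorProduct.add_tmul, TensorProduct.sum_tmul, add_assoc, ← Finset.sum_add_distrib]
  congr 1
  · rw [coeff_one]
    split_ifs <;> simp [one_def]
  · refine Finset.sum_congr rfl fun n hn => ?_
    rw [hB n (Finset.mem_Icc.1 hn).1, add_comm]

/-- The coproduct of the solution of a Dyson-Schwinger equation. -/
theorem map_comul_eq {κ : K} {B : ℕ → H →ₗ[K] H} (hB : ∀ n, 1 ≤ n → IsOneCocycle (B n))
    {S : PowerSeries H} (hS : IsDSESolution κ B S) :
    PowerSeries.map (Bialgebra.comulAlgHom K H : H →+* H ⊗[K] H) S =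
      PowerSeries.map ((includeLeft : H →ₐ[K] H ⊗[K] H) : H →+* H ⊗[K] H) S *
      (PowerSeries.map ((includeRight : H →ₐ[K] H ⊗[K] H) : H →+* H ⊗[K] H) S).subst
        (X * genPow (PowerSeries.map ((includeLeft : H →ₐ[K] H ⊗[K] H) : H →+* H ⊗[K] H) S) κ) := by
  set X₁ := PowerSeries.map ((includeLeft : H →ₐ[K] H ⊗[K] H) : H →+* H ⊗[K] H) S with hX₁
  set X₂ := PowerSeries.map ((includeRight : H →ₐ[K] H ⊗[K] H) : H →+* H ⊗[K] H) S with hX₂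
  have h₁ : constantCoeff X₁ = 1 := constantCoeff_map_eq_one _ hS.constantCoeff_eq
  have h₂ : constantCoeff X₂ = 1 := constantCoeff_map_eq_one _ hS.constantCoeff_eq
  refine (existsUnique_dseMap h₁ κ fun n => (B n).lTensor H).unique
    (map_comul_eq_dseMap hB hS) ?_
  have hs := hasSubst_X_mul (genPow X₁ κ)
  have h₃ : constantCoeff (X₂.subst (X * genPow X₁ κ)) = 1 := by
    rw [← coeff_zero_eq_constantCoeff_apply, coeff_subst_eq_sum (by simp)]
    simp [h₂]
  ext m
  rw [coeff_dseMap]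
  -- Writing `X₁` as `X₁^1` makes the coefficient formula applicable with `q = 1`.
  conv_lhs => enter [2, 1]; rw [← genPow_one (K := K) h₁]
  rw [coeff_genPow_mul_subst _ h₁]
  simp only [genPow_mul h₁ h₃, ← subst_genPow h₂ hs, coeff_genPow_mul_subst _ h₁]
  have hX₂c : ∀ k, coeff k X₂ = _ := fun k => map_includeRight_eq hS k
  simp only [hX₂c, add_mul, Finset.sum_add_distrib, Finset.sum_mul]
  congr 1
  -- The constant term `1` of `X₂` contributes the inhomogeneous term `X₁`.
  · rw [Finset.sum_eq_single 0 (fun k _ hk => by simp [coeff_one, hk]) (by simp)]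
    simp [genPow_one (K := K) h₁]
  -- Sum over the index `n` of `Bₙ` first, then write the index of the coefficient of `X₂` as `n +
  -- j`. The exponent `1 + (n + j)κ` becomes `(1 + nκ) + jκ`, as on the other side.
  · rw [Finset.sum_comm' (t' := Finset.Icc 1 m) (s' := fun n => Finset.Ico n (m + 1))
      (by intro x y; simp only [Finset.mem_range, Finset.mem_Icc, Finset.mem_Ico]; omega)]
    refine Finset.sum_congr rfl fun n hn => ?_
    rw [Finset.mem_Icc] at hn
    rw [Finset.sum_Ico_eq_sum_range, map_sum, Nat.sub_add_comm hn.2]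
    refine Finset.sum_congr rfl fun j _ => ?_
    rw [hX₁, hX₂, coeff_genPow_map _ hS.constantCoeff_eq, coeff_genPow_map _ hS.constantCoeff_eq,
      coeff_genPow_map _ hS.constantCoeff_eq,
      Nat.add_sub_cancel_left, Nat.sub_sub, Nat.cast_add, add_mul, add_assoc]
    rw [mul_comm, ← lTensor_includeLeft_mul, mul_comm]

theorem comul_coeff_eq {κ : K} {B : ℕ → H →ₗ[K] H} (hB : ∀ n, 1 ≤ n → IsOneCocycle (B n))
    {S : PowerSeries H} (hS : IsDSESolution κ B S) (m : ℕ) :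
    Coalgebra.comul (R := K) (coeff m S) = ∑ n ∈ Finset.range (m + 1),
      coeff (m - n) (genPow S (1 + n * κ)) ⊗ₜ[K] coeff n S := by
  have hc : constantCoeff
      (PowerSeries.map ((includeLeft : H →ₐ[K] H ⊗[K] H) : H →+* H ⊗[K] H) S) = 1 := by
    rw [← coeff_zero_eq_constantCoeff_apply, coeff_map, coeff_zero_eq_constantCoeff_apply,
      hS.constantCoeff_eq, map_one]
  have h := congr(coeff m $(map_comul_eq hB hS))
  conv_rhs at h => enter [2, 1]; rw [← genPow_one (K := K) hc]
  rw [coeff_genPow_mul_subst _ hc] at h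
  refine h.trans (Finset.sum_congr rfl fun n _ => ?_)
  rw [← map_genPow _ hS.constantCoeff_eq, coeff_map, coeff_map]
  simp

end Coproduct

/-! ### Cocycles on polynomials and the universal property of rooted trees -/

section FeynmanRules

open Polynomial

variable {K : Type*} [Field K]

/-- Coassociativity handles the part `(id ⊗ α) ∘ Δ`. The correction `α(·)1`, applied in the right
factor, produces `-(id ⊗ α)Δx ⊗ 1`, which cancels against `L x ⊗ 1` up to `-α(x) 1 ⊗ 1`. -/
theorem isOneCocycle_coboundary {H : Type*} [CommRing H] [Bialgebra K H] (α : H →ₗ[K] K) :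
    IsOneCocycle (coboundary α) := by
  intro x
  have h1 : ∀ t : H ⊗[K] H,
      Coalgebra.comul (R := K) (TensorProduct.rid K H (α.lTensor H t)) =
      (((TensorProduct.rid K H).toLinearMap ∘ₗ α.lTensor H).lTensor H)
        (TensorProduct.assoc K H H H ((Coalgebra.comul (R := K)).rTensor H t)) := by
    intro t
    induction t using TensorProduct.induction_on with
    | zero => simp
    | add x y hx hy => simp only [map_add, hx, hy]
    | tmul x y =>
      simp only [LinearMap.lTensor_tmul, LinearMap.rTensor_tmul, TensorProduct.rid_tmul, map_smul]
      induction Coalgebra.comul (R := K) x using TensorProduct.induction_on with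
      | zero => simp
      | add c d hc hd => simp only [TensorProduct.add_tmul, map_add, smul_add, hc, hd]
      | tmul c d => simp
  have h2 : ∀ t : H ⊗[K] H, (Algebra.linearMap K H ∘ₗ α).lTensor H t =
      TensorProduct.rid K H (α.lTensor H t) ⊗ₜ[K] 1 := by
    intro t
    induction t using TensorProduct.induction_on with
    | zero => simp
    | add x y hx hy => simp only [map_add, TensorProduct.add_tmul, hx, hy]
    | tmul x y => simp [Algebra.algebraMap_eq_smul_one, TensorProduct.smul_tmul]
  have h3 : (coboundary α).lTensor H (Coalgebra.comul (R := K) x) =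
      (((TensorProduct.rid K H).toLinearMap ∘ₗ α.lTensor H).lTensor H)
        ((Coalgebra.comul (R := K)).lTensor H (Coalgebra.comul (R := K) x)) -
      (Algebra.linearMap K H ∘ₗ α).lTensor H (Coalgebra.comul (R := K) x) := by
    rw [coboundary, LinearMap.lTensor_sub, LinearMap.sub_apply, ← LinearMap.comp_assoc,
      LinearMap.lTensor_comp]
    rfl
  rw [h3, h2, ← Coalgebra.coassoc_apply, ← h1]
  simp [coboundary, TensorProduct.sub_tmul, Algebra.algebraMap_eq_smul_one,
    Algebra.TensorProduct.one_def, TensorProduct.smul_tmul']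

theorem comul_X_pow (n : ℕ) : Coalgebra.comul (R := K) (X ^ n : K[X]) =
    ∑ k ∈ Finset.range (n + 1), (n.choose k : K) • ((X ^ k : K[X]) ⊗ₜ[K] (X ^ (n - k) : K[X])) := by
  have h : Coalgebra.comul (R := K) (X ^ n : K[X]) =
      aeval (R := K) ((X : K[X]) ⊗ₜ[K] (1 : K[X]) + 1 ⊗ₜ X) (X ^ n : K[X]) := rfl
  rw [h, map_pow, aeval_X, (Commute.all _ _).add_pow]
  refine Finset.sum_congr rfl fun k _ => ?_
  simp [Algebra.TensorProduct.tmul_pow, Nat.cast_smul_eq_nsmul, mul_comm]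

theorem isOneCocycle_integration [CharZero K] : IsOneCocycle (integration K) := by
  have hi : ∀ n : ℕ, integration K (X ^ n) = ((n : K) + 1)⁻¹ • (X ^ (n + 1) : K[X]) := by
    intro n
    have := (basisMonomials K).constr_basis K (fun n => monomial (n + 1) (((n : K) + 1)⁻¹)) n
    rw [coe_basisMonomials] at this
    simp only [← X_pow_eq_monomial] at this
    rw [integration, this, ← C_mul_X_pow_eq_monomial, smul_eq_C_mul]
  have hl : Coalgebra.comul ∘ₗ integration K = (integration K).lTensor K[X] ∘ₗ Coalgebra.comul +
      (TensorProduct.mk K K[X] K[X]).flip 1 ∘ₗ integration K := by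
    refine (basisMonomials K).ext fun n => ?_
    simp only [coe_basisMonomials, ← X_pow_eq_monomial, LinearMap.comp_apply, LinearMap.add_apply,
      LinearMap.flip_apply, TensorProduct.mk_apply]
    -- The top term `k = n + 1` is `L(xⁿ) ⊗ 1`. The others match by `(n+1 choose k) / (n+1) = (n
    -- choose k) / (n+1-k)`.
    rw [hi, map_smul, comul_X_pow, comul_X_pow, Finset.sum_range_succ, smul_add, map_sum]
    congr 1
    · rw [Finset.smul_sum]
      refine Finset.sum_congr rfl fun k hk => ?_
      have hk : k ≤ n := by simpa [Nat.lt_succ_iff] using hk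
      rw [map_smul, LinearMap.lTensor_tmul, hi, TensorProduct.tmul_smul, smul_smul, smul_smul,
        Nat.succ_sub hk]
      congr 1
      have h1 : ((n : K) + 1) ≠ 0 := by exact_mod_cast n.succ_ne_zero
      have h2 : (((n - k : ℕ) : K) + 1) ≠ 0 := by exact_mod_cast (n - k).succ_ne_zero
      field_simp
      have := Nat.choose_mul_succ_eq n k
      rw [Nat.succ_sub hk] at this
      have := congr(($this : K))
      push_cast at this
      linear_combination -this
    · simp [TensorProduct.smul_tmul']
  exact fun x => congr($hl x)

theorem IsOneCocycle.add {H : Type*} [CommRing H] [Bialgebra K H] {L L' : H →ₗ[K] H}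
    (h : IsOneCocycle L) (h' : IsOneCocycle L') : IsOneCocycle (L + L') := by
  intro x
  simp only [LinearMap.add_apply, map_add, h x, h' x, LinearMap.lTensor_add, TensorProduct.add_tmul]
  abel

theorem IsOneCocycle.smul {H : Type*} [CommRing H] [Bialgebra K H] {L : H →ₗ[K] H}
    (h : IsOneCocycle L) (c : K) : IsOneCocycle (c • L) := by
  intro x
  simp only [LinearMap.smul_apply, map_smul, h x, LinearMap.lTensor_smul, smul_add,
    TensorProduct.smul_tmul']

theorem isOneCocycle_mellinCocycle [CharZero K] (cres : K) (c : ℕ → K) :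
    IsOneCocycle (mellinCocycle cres c) :=
  (isOneCocycle_integration.smul _).add (isOneCocycle_coboundary _)

section Universal

variable {A : Type*} [CommRing A]

/-- The value of the algebra morphism determined by `L` on the branches of a planar tree. -/
def branchValuePlanar (L : A → A) : PlanarTree → A
  | .leaf => 1
  | .graft a b => L (branchValuePlanar L a) * branchValuePlanar L b

/-- `branchValuePlanar` on isomorphism classes. -/
def branchValue (L : A → A) : RTree → A :=
  Quotient.lift (branchValuePlanar L) (by
    intro a b h
    change PlanarTree.Iso a b at h
    induction h with
    | refl a => rfl
    | symm _ ih => exact ih.symm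
    | trans _ _ ih ih' => exact ih.trans ih'
    | congr h h' ih ih' => simp only [branchValuePlanar, ih, ih']
    | swap a b c => simp only [branchValuePlanar]; ring)

theorem branchValue_graft (L : A → A) (a b : RTree) :
    branchValue L (RTree.graft a b) = L (branchValue L a) * branchValue L b := by
  induction a, b using Quotient.inductionOn₂
  rfl

variable [Algebra K A]

/-- The algebra morphism with `φ ∘ B₊ = L ∘ φ`. -/
noncomputable def liftBplus (L : A →ₗ[K] A) : HR K →ₐ[K] A :=
  liftTrees K fun t => L (branchValue L t)

theorem liftBplus_Bplus (L : A →ₗ[K] A) (f : HR K) :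
    liftBplus L (Bplus K f) = L (liftBplus L f) := by
  have hb : ∀ s, liftBplus L (branches K s) = branchValue L (RTree.node s) := by
    intro s
    induction s using Multiset.induction with
    | empty => simp [branches]; rfl
    | cons t s ih =>
      rw [RTree.node_cons, branchValue_graft, ← ih]
      simp [branches, liftBplus]
  have : (liftBplus L).toLinearMap ∘ₗ Bplus K = L ∘ₗ (liftBplus L).toLinearMap := by
    refine linearMap_ext K fun s => ?_
    simp only [LinearMap.comp_apply, AlgHom.toLinearMap_apply, Bplus_branches, hb]
    simp [liftBplus]
  exact congr($this f)

end Universal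

/-- The bialgebra morphism with `φ ∘ B₊ = L ∘ φ`, for a one-cocycle `L`. -/
noncomputable def liftCocycle {H : Type*} [CommRing H] [Bialgebra K H] (L : H →ₗ[K] H)
    (hL : IsOneCocycle L) : HR K →ₐc[K] H :=
  BialgHom.ofAlgHom (liftBplus L)
    (by
      apply algHom_ext_Bplus
      intro x _
      simp only [AlgHom.comp_apply, Bialgebra.counitAlgHom_apply, liftBplus_Bplus,
        hL.counit_eq_zero]
      exact (counit_Bplus K x).symm)
    (by
      apply algHom_ext_Bplus
      intro x hx
      -- As `φ` intertwines `B₊` with `L`, both `Δ ∘ φ` and `(φ ⊗ φ) ∘ Δ` obey the same recursion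
      -- along `B₊`.
      have h1 : ∀ y : HR K ⊗[K] HR K, Algebra.TensorProduct.map (liftBplus L) (liftBplus L)
          ((Bplus K).lTensor (HR K) y) =
          L.lTensor H (Algebra.TensorProduct.map (liftBplus L) (liftBplus L) y) := by
        intro y
        induction y using TensorProduct.induction_on with
        | zero => simp
        | add a b ha hb => simp only [map_add, ha, hb]
        | tmul a b => simp [liftBplus_Bplus]
      simp only [AlgHom.comp_apply, Bialgebra.comulAlgHom_apply] at hx ⊢
      have h2 : ∀ y : HR K, Coalgebra.comul (R := K) y = comulHR K y := fun _ => rfl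
      rw [h2] at hx ⊢
      rw [comul_Bplus, map_add, h1, hx, liftBplus_Bplus, hL, add_comm]
      simp [liftBplus_Bplus])

theorem liftCocycle_apply {H : Type*} [CommRing H] [Bialgebra K H] (L : H →ₗ[K] H)
    (hL : IsOneCocycle L) (x : HR K) : liftCocycle L hL x = liftBplus L x := rfl

theorem existsUnique_liftCocycle {H : Type*} [CommRing H] [Bialgebra K H] (L : H →ₗ[K] H)
    (hL : IsOneCocycle L) : ∃ φ : HR K →ₐc[K] H, (∀ f, φ (Bplus K f) = L (φ f)) ∧
      ∀ ψ : HR K →ₐ[K] H, (∀ f, ψ (Bplus K f) = L (ψ f)) → ∀ f, ψ f = φ f := by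
  refine ⟨liftCocycle L hL, liftBplus_Bplus L, fun ψ hψ f => ?_⟩
  have : ψ = liftBplus L := algHom_ext_Bplus K fun x hx => by rw [hψ, liftBplus_Bplus, hx]
  rw [this, liftCocycle_apply]

end FeynmanRules

/-! ### Translation and differentiation as convolutions on polynomials -/

section PolynomialCoproduct

open Polynomial

variable {K : Type*} [Field K]

theorem comul_mul_X (p : K[X]) : Coalgebra.comul (R := K) (p * X) =
    Coalgebra.comul (R := K) p * ((X : K[X]) ⊗ₜ[K] (1 : K[X]) + 1 ⊗ₜ X) := by
  have h : ∀ q : K[X], Coalgebra.comul (R := K) q =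
      aeval (R := K) ((X : K[X]) ⊗ₜ[K] (1 : K[X]) + 1 ⊗ₜ X) q := fun _ => rfl
  rw [h, h, map_mul, aeval_X]

theorem linearMap_eq_of_mul_X {M : Type*} [AddCommMonoid M] [Module K M] {f g : K[X] →ₗ[K] M}
    (h1 : f 1 = g 1) (hX : ∀ p, f p = g p → f (p * X) = g (p * X)) : f = g := by
  refine (basisMonomials K).ext fun n => ?_
  simp only [coe_basisMonomials, ← X_pow_eq_monomial]
  induction n with
  | zero => simpa using h1
  | succ n ih => rw [pow_succ]; exact hX _ ih

/-- Under `ev_a ⊗ ev_b`, multiplication by `x ⊗ 1 + 1 ⊗ x` becomes multiplication by `a + b`, so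
both functionals obey the same recursion in the degree. -/
theorem leval_add_eq_convolution (a b : K) :
    leval (a + b) = convolution (leval a : K[X] →ₗ[K] K) (leval b) := by
  have h : ∀ t : K[X] ⊗[K] K[X], LinearMap.mul' K K (TensorProduct.map (leval a) (leval b)
      (t * (X ⊗ₜ 1 + 1 ⊗ₜ X))) =
      LinearMap.mul' K K (TensorProduct.map (leval a) (leval b) t) * (a + b) := by
    intro t
    induction t using TensorProduct.induction_on with
    | zero => simp
    | add x y hx hy => simp only [add_mul _ _ (_ + _), map_add, hx, hy]
    | tmul x y => simp [mul_add]; ring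
  refine linearMap_eq_of_mul_X (by simp [convolution, Algebra.TensorProduct.one_def]) fun p hp => ?_
  simp only [convolution, LinearMap.comp_apply, comul_mul_X, h] at hp ⊢
  rw [← hp]
  simp

/-- The functional `p ↦ p'(0)`. -/
noncomputable def derivAtZero (K : Type*) [Field K] : K[X] →ₗ[K] K := leval 0 ∘ₗ derivative

/-- Infinitesimal form of translation: differentiate `p(x + y)` in `y` at `0`. In the recursion `p ↦
p * X`, the extra term of the product rule is `(id ⊗ ε)Δp = p`. -/
theorem derivative_eq_map_derivAtZero (p : K[X]) : derivative p =
    LinearMap.mul' K K[X] (TensorProduct.map LinearMap.id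
      (Algebra.linearMap K K[X] ∘ₗ derivAtZero K) (Coalgebra.comul (R := K) p)) := by
  have h : ∀ t : K[X] ⊗[K] K[X], LinearMap.mul' K K[X] (TensorProduct.map LinearMap.id
      (Algebra.linearMap K K[X] ∘ₗ derivAtZero K) (t * (X ⊗ₜ 1 + 1 ⊗ₜ X))) =
      LinearMap.mul' K K[X] (TensorProduct.map LinearMap.id
        (Algebra.linearMap K K[X] ∘ₗ derivAtZero K) t) * X +
      TensorProduct.rid K K[X] ((Coalgebra.counit (R := K)).lTensor K[X] t) := by
    intro t
    have hc : ∀ q : K[X], Coalgebra.counit (R := K) q = aeval 0 q := fun _ => rfl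
    induction t using TensorProduct.induction_on with
    | zero => simp
    | add x y hx hy => simp only [add_mul _ _ (_ + _), add_mul _ _ X, map_add, hx, hy]; abel
    | tmul x y =>
      simp [mul_add, derivAtZero, hc, smul_eq_C_mul]; ring
  have e : (derivative : K[X] →ₗ[K] K[X]) = LinearMap.mul' K K[X] ∘ₗ TensorProduct.map LinearMap.id
      (Algebra.linearMap K K[X] ∘ₗ derivAtZero K) ∘ₗ Coalgebra.comul := by
    refine linearMap_eq_of_mul_X (by simp [Algebra.TensorProduct.one_def, derivAtZero])
      fun p hp => ?_
    simp only [LinearMap.comp_apply, comul_mul_X, h] at hp ⊢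
    rw [← hp]
    simp
  exact congr($e p)

/-- The mirror image. Both versions are needed: the side on which `∂₀` acts decides which form of
the renormalization group equation results. -/
theorem derivative_eq_derivAtZero_map (p : K[X]) : derivative p =
    LinearMap.mul' K K[X] (TensorProduct.map (Algebra.linearMap K K[X] ∘ₗ derivAtZero K)
      LinearMap.id (Coalgebra.comul (R := K) p)) := by
  have h : ∀ t : K[X] ⊗[K] K[X], LinearMap.mul' K K[X] (TensorProduct.map
      (Algebra.linearMap K K[X] ∘ₗ derivAtZero K) LinearMap.id (t * (X ⊗ₜ 1 + 1 ⊗ₜ X))) =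
      LinearMap.mul' K K[X] (TensorProduct.map
        (Algebra.linearMap K K[X] ∘ₗ derivAtZero K) LinearMap.id t) * X +
      TensorProduct.lid K K[X] ((Coalgebra.counit (R := K)).rTensor K[X] t) := by
    intro t
    have hc : ∀ q : K[X], Coalgebra.counit (R := K) q = aeval 0 q := fun _ => rfl
    induction t using TensorProduct.induction_on with
    | zero => simp
    | add x y hx hy => simp only [add_mul _ _ (_ + _), add_mul _ _ X, map_add, hx, hy]; abel
    | tmul x y =>
      simp [mul_add, derivAtZero, hc, smul_eq_C_mul]; ring
  have e : (derivative : K[X] →ₗ[K] K[X]) = LinearMap.mul' K K[X] ∘ₗ TensorProduct.map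
      (Algebra.linearMap K K[X] ∘ₗ derivAtZero K) LinearMap.id ∘ₗ Coalgebra.comul := by
    refine linearMap_eq_of_mul_X (by simp [Algebra.TensorProduct.one_def, derivAtZero])
      fun p hp => ?_
    simp only [LinearMap.comp_apply, comul_mul_X, h] at hp ⊢
    rw [← hp]
    simp
  exact congr($e p)

end PolynomialCoproduct

/-! ### Renormalization group equations for correlation functions -/

section RenormalizationGroup

open Polynomial hiding coeff coeff_map
open PowerSeries (coeff constantCoeff coeff_mk coeff_map)

variable {K : Type*} [Field K]

theorem coeff_mapCoeff [CharZero K] {A A' : Type*} [CommRing A] [Algebra K A] [CommRing A']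
    [Algebra K A'] (φ : A →ₗ[K] A') (f : PowerSeries A) (n : ℕ) :
    coeff n (mapCoeff φ f) = φ (coeff n f) := coeff_mk _ _

/-- A derivation along a character `e` sends `f^p` to `p` times the image of `f` if `e f = 1`. -/
theorem derivation_coeff_genPow [CharZero K] {A : Type*} [CommRing A] [Algebra K A]
    (e : A →ₐ[K] K) (δ : A →ₗ[K] K) (hδ : ∀ x y, δ (x * y) = δ x * e y + e x * δ y)
    {f : PowerSeries A} (hf : constantCoeff f = 1)
    (he : ∀ n, e (coeff n f) = coeff n (1 : PowerSeries K)) (p : K) (n : ℕ) :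
    δ (coeff n (genPow f p)) = p * δ (coeff n f) := by
  have h1 : δ 1 = 0 := by simpa using hδ 1 1
  have hc : ∀ n, δ (coeff n (1 : PowerSeries A)) = 0 := by
    intro n
    rw [PowerSeries.coeff_one]
    split_ifs <;> simp [h1]
  have hz : ∀ n, e (coeff n (f - 1)) = 0 := by
    intro n
    rw [map_sub, map_sub, he, PowerSeries.coeff_one, PowerSeries.coeff_one]
    split_ifs <;> simp
  -- Coefficients of `f - 1` lie in the kernel of `e`, and a derivation along `e` kills products of
  -- two such elements. Only the linear term of the binomial series survives.
  have hp : ∀ d n, δ (coeff n ((f - 1) ^ (d + 2))) = 0 := by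
    intro d n
    have hz' : ∀ d n, e (coeff n ((f - 1) ^ (d + 1))) = 0 := by
      intro d n
      rw [pow_succ, PowerSeries.coeff_mul, map_sum]
      exact Finset.sum_eq_zero fun x _ => by rw [map_mul, hz, mul_zero]
    rw [pow_succ, PowerSeries.coeff_mul, map_sum]
    exact Finset.sum_eq_zero fun x _ => by rw [hδ, hz, hz', mul_zero, zero_mul, add_zero]
  rw [coeff_genPow hf, map_sum, Finset.sum_eq_single 1]
  · rw [pow_one, map_smul, map_sub, map_sub, hc, sub_zero, Ring.choose_one_right, smul_eq_mul]
  · intro d _ hd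
    match d, hd with
    | 0, _ => rw [pow_zero, map_smul, hc, smul_zero]
    | d + 2, _ => rw [map_smul, hp, smul_zero]
  -- For `n = 0` the index `d = 1` lies outside the sum, but the corresponding term vanishes because
  -- `f` has constant coefficient `1`.
  · intro h
    have : n = 0 := by simpa using h
    subst this
    simp [hf]

/-- The specialization `ev_a ∘ φ` as an algebra morphism. -/
noncomputable def evalAtAlgHom (φ : HR K →ₐc[K] K[X]) (a : K) : HR K →ₐ[K] K :=
  (aeval a).comp (φ : HR K →ₐ[K] K[X])

theorem evalAtAlgHom_apply (φ : HR K →ₐc[K] K[X]) (a : K) (x : HR K) :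
    evalAtAlgHom φ a x = evalAt φ a x := by
  simp [evalAtAlgHom, evalAt, coe_aeval_eq_eval]

theorem linearMap_comp_anomalousDim (φ : HR K →ₐc[K] K[X]) :
    Algebra.linearMap K K[X] ∘ₗ anomalousDim φ =
      -((Algebra.linearMap K K[X] ∘ₗ derivAtZero K) ∘ₗ (φ : HR K →ₗ[K] K[X])) := by
  ext1 x
  simp [anomalousDim, derivAtZero]

theorem map_comul (φ : HR K →ₐc[K] K[X]) (x : HR K) :
    Coalgebra.comul (R := K) (φ x) = TensorProduct.map (φ : HR K →ₗ[K] K[X])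
      (φ : HR K →ₗ[K] K[X]) (Coalgebra.comul (R := K) x) :=
  (CoalgHomClass.map_comp_comul_apply φ x).symm

theorem evalAt_add (φ : HR K →ₐc[K] K[X]) (a b : K) :
    evalAt φ (a + b) = convolution (evalAt φ a) (evalAt φ b) := by
  ext x
  rw [evalAt, LinearMap.comp_apply, leval_add_eq_convolution, convolution, convolution]
  simp only [LinearMap.comp_apply]
  change LinearMap.mul' K K
    (TensorProduct.map (leval a) (leval b) (Coalgebra.comul (R := K) (φ x))) = _
  rw [map_comul, ← LinearMap.comp_apply (TensorProduct.map _ _), ← TensorProduct.map_comp]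
  rfl

theorem neg_derivative_eq_map_anomalousDim (φ : HR K →ₐc[K] K[X]) (x : HR K) :
    -derivative (φ x) = LinearMap.mul' K K[X] (TensorProduct.map (φ : HR K →ₗ[K] K[X])
      (Algebra.linearMap K K[X] ∘ₗ anomalousDim φ) (Coalgebra.comul (R := K) x)) := by
  rw [derivative_eq_map_derivAtZero, map_comul, ← LinearMap.comp_apply (TensorProduct.map _ _),
    ← TensorProduct.map_comp, linearMap_comp_anomalousDim, LinearMap.id_comp]
  induction Coalgebra.comul (R := K) x using TensorProduct.induction_on with
  | zero => simp
  | add y z hy hz => rw [map_add, map_add, map_add, map_add, neg_add, hy, hz]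
  | tmul y z => simp

theorem neg_derivative_eq_anomalousDim_map (φ : HR K →ₐc[K] K[X]) (x : HR K) :
    -derivative (φ x) = LinearMap.mul' K K[X] (TensorProduct.map
      (Algebra.linearMap K K[X] ∘ₗ anomalousDim φ) (φ : HR K →ₗ[K] K[X])
      (Coalgebra.comul (R := K) x)) := by
  rw [derivative_eq_derivAtZero_map, map_comul, ← LinearMap.comp_apply (TensorProduct.map _ _),
    ← TensorProduct.map_comp, linearMap_comp_anomalousDim, LinearMap.id_comp]
  induction Coalgebra.comul (R := K) x using TensorProduct.induction_on with
  | zero => simp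
  | add y z hy hz => rw [map_add, map_add, map_add, map_add, neg_add, hy, hz]
  | tmul y z => simp

/-- The counit of `HR K` is `ev₀ ∘ φ`, so this is the Leibniz rule evaluated at `ℓ = 0`. -/
theorem anomalousDim_mul (φ : HR K →ₐc[K] K[X]) (x y : HR K) : anomalousDim φ (x * y) =
    anomalousDim φ x * Bialgebra.counitAlgHom K (HR K) y +
      Bialgebra.counitAlgHom K (HR K) x * anomalousDim φ y := by
  have h : ∀ x, Bialgebra.counitAlgHom K (HR K) x = eval 0 (φ x) := by
    intro x
    rw [Bialgebra.counitAlgHom_apply, ← CoalgHomClass.counit_comp_apply φ]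
    change aeval 0 (φ x) = _
    rw [coe_aeval_eq_eval]
  rw [h, h]
  simp [anomalousDim, derivative_mul]
  ring

variable [CharZero K]

theorem correlationAt_eq_map (φ : HR K →ₐc[K] K[X]) (S : PowerSeries (HR K)) (a : K) :
    correlationAt φ S a = PowerSeries.map (evalAtAlgHom φ a : HR K →+* K) S := by
  ext n
  rw [correlationAt, correlation, coeff_mapCoeff, coeff_mapCoeff, coeff_map]
  exact (evalAtAlgHom_apply φ a _).symm

theorem correlation_eq_map (φ : HR K →ₐc[K] K[X]) (S : PowerSeries (HR K)) :
    correlation φ S = PowerSeries.map ((φ : HR K →ₐ[K] K[X]) : HR K →+* K[X]) S := by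
  ext1 n
  rw [correlation, coeff_mapCoeff, coeff_map]
  rfl

variable {κ : K} {B : ℕ → HR K →ₗ[K] HR K} {S : PowerSeries (HR K)}

theorem correlationAt_add_eq_convolution (φ : HR K →ₐc[K] K[X]) (S : PowerSeries (HR K)) (a b : K) :
    correlationAt φ S (a + b) = mapCoeff (convolution (evalAt φ a) (evalAt φ b)) S := by
  rw [← evalAt_add]
  ext n
  rw [correlationAt, correlation, coeff_mapCoeff, coeff_mapCoeff, coeff_mapCoeff]
  rfl

/-- Apply `φ_a ⊗ φ_b` to the coproduct formula; the character `φ_a` passes into the powers in the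
left factor. -/
theorem correlationAt_add (hB : ∀ n, 1 ≤ n → IsOneCocycle (B n)) (hS : IsDSESolution κ B S)
    (φ : HR K →ₐc[K] K[X]) (a b : K) :
    correlationAt φ S (a + b) = correlationAt φ S a *
      (correlationAt φ S b).subst (PowerSeries.X * genPow (correlationAt φ S a) κ) := by
  have hc := constantCoeff_map_eq_one (evalAtAlgHom φ a) hS.constantCoeff_eq
  rw [correlationAt_add_eq_convolution, correlationAt_eq_map, correlationAt_eq_map]
  ext m
  conv_rhs => enter [2, 1]; rw [← genPow_one (K := K) hc]
  rw [coeff_genPow_mul_subst _ hc, coeff_mapCoeff, convolution, LinearMap.comp_apply,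
    LinearMap.comp_apply, comul_coeff_eq hB hS, map_sum, map_sum]
  refine Finset.sum_congr rfl fun n _ => ?_
  rw [coeff_genPow_map _ hS.constantCoeff_eq, coeff_map, RingHom.coe_coe, evalAtAlgHom_apply,
    evalAtAlgHom_apply, TensorProduct.map_tmul, LinearMap.mul'_apply, mul_comm]

theorem neg_derivative_correlation_eq_mul_subst (hB : ∀ n, 1 ≤ n → IsOneCocycle (B n))
    (hS : IsDSESolution κ B S) (φ : HR K →ₐc[K] K[X]) :
    -mapCoeff derivative (correlation φ S) = correlation φ S *
      (PowerSeries.map C (physicalAnomalousDim φ S)).subst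
        (PowerSeries.X * genPow (correlation φ S) κ) := by
  have hc := constantCoeff_map_eq_one (φ : HR K →ₐ[K] K[X]) hS.constantCoeff_eq
  ext1 m
  have hm : coeff m (-mapCoeff derivative (correlation φ S)) = -derivative (φ (coeff m S)) := by
    rw [map_neg, coeff_mapCoeff, correlation, coeff_mapCoeff]
    rfl
  rw [hm, correlation_eq_map]
  conv_rhs => enter [2, 1]; rw [← genPow_one (K := K) hc]
  rw [coeff_genPow_mul_subst _ hc, neg_derivative_eq_map_anomalousDim, comul_coeff_eq hB hS,
    map_sum, map_sum]
  refine Finset.sum_congr rfl fun n _ => ?_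
  rw [coeff_genPow_map _ hS.constantCoeff_eq, coeff_map, physicalAnomalousDim, coeff_mapCoeff,
    TensorProduct.map_tmul, LinearMap.mul'_apply, mul_comm]
  rfl

/-- Cocycles take values in the kernel of the counit, so only the term `1` of the equation survives.
-/
theorem counit_coeff_eq (hB : ∀ n, 1 ≤ n → IsOneCocycle (B n)) (hS : IsDSESolution κ B S) (n : ℕ) :
    Bialgebra.counitAlgHom K (HR K) (coeff n S) = coeff n (1 : PowerSeries K) := by
  rw [hS.coeff_eq, map_add, map_sum, Finset.sum_eq_zero, add_zero, PowerSeries.coeff_one,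
    PowerSeries.coeff_one]
  · split_ifs <;> simp
  · intro k hk
    exact (hB k (Finset.mem_Icc.1 hk).1).counit_eq_zero _

/-- With `γ` on the left factor of `Δ xₘ`, each power `X^(1+nκ)` contributes `(1 + nκ) γ(x_(m-n))`,
leaving a Cauchy product in which the factor `n` is the effect of `g ∂_g` on `gⁿ`. -/
theorem neg_derivative_correlation_eq_mul_add (hB : ∀ n, 1 ≤ n → IsOneCocycle (B n))
    (hS : IsDSESolution κ B S) (φ : HR K →ₐc[K] K[X]) :
    -mapCoeff derivative (correlation φ S) = PowerSeries.map C (physicalAnomalousDim φ S) *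
      (correlation φ S + PowerSeries.C (C κ) *
        (PowerSeries.X * PowerSeries.derivative K[X] (correlation φ S))) := by
  ext1 m
  have hm : coeff m (-mapCoeff derivative (correlation φ S)) = -derivative (φ (coeff m S)) := by
    rw [map_neg, coeff_mapCoeff, correlation, coeff_mapCoeff]
    rfl
  rw [hm, neg_derivative_eq_anomalousDim_map, comul_coeff_eq hB hS, map_sum, map_sum, mul_comm,
    PowerSeries.coeff_mul, Finset.Nat.sum_antidiagonal_eq_sum_range_succ_mk]
  refine Finset.sum_congr rfl fun n _ => ?_
  rw [coeff_map, physicalAnomalousDim, coeff_mapCoeff, TensorProduct.map_tmul,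
    LinearMap.mul'_apply, LinearMap.comp_apply,
    derivation_coeff_genPow _ _ (anomalousDim_mul φ) hS.constantCoeff_eq (counit_coeff_eq hB hS)]
  have hx : ∀ G : PowerSeries K[X], coeff n (PowerSeries.X * PowerSeries.derivative K[X] G) =
      n * coeff n G := by
    intro G
    cases n with
    | zero => simp
    | succ n => rw [PowerSeries.coeff_succ_X_mul, PowerSeries.coeff_derivative]; push_cast; ring
  rw [map_add, PowerSeries.coeff_C_mul, hx, correlation, coeff_mapCoeff]
  simp only [Algebra.linearMap_apply, algebraMap_eq, C_mul, C_add, C_1, map_natCast]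
  ring

end RenormalizationGroup

end DysonSchwinger

open DysonSchwinger in
theorem mainTheorem7 {K : Type*} [Field K] [CharZero K] :
    -- the renormalized Feynman rules attached to arbitrary Mellin coefficients exist, are unique,
    -- and are a morphism of bialgebras
    (∀ (cres : K) (c : ℕ → K), ∃ φ : HR K →ₐc[K] Polynomial K,
      (∀ f : HR K, φ (Bplus K f) = mellinCocycle cres c (φ f)) ∧
      ∀ ψ : HR K →ₐ[K] Polynomial K,
        (∀ f : HR K, ψ (Bplus K f) = mellinCocycle cres c (ψ f)) → ∀ f, ψ f = φ f) ∧
    ∀ (κ : K) (B : ℕ → HR K →ₗ[K] HR K), (∀ n, 1 ≤ n → IsOneCocycle (B n)) →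
      (∃! S : PowerSeries (HR K), IsDSESolution κ B S) ∧
      ∀ S : PowerSeries (HR K), IsDSESolution κ B S → ∀ φ : HR K →ₐc[K] Polynomial K,
        -- the functional equations for all values of the scale
        (∀ a b : K,
          correlationAt φ S (a + b) = mapCoeff (convolution (evalAt φ a) (evalAt φ b)) S ∧
          correlationAt φ S (a + b) = correlationAt φ S a *
            (correlationAt φ S b).subst (PowerSeries.X * genPow (correlationAt φ S a) κ) ∧
          correlationAt φ S (a + b) = correlationAt φ S b *
            (correlationAt φ S a).subst (PowerSeries.X * genPow (correlationAt φ S b) κ)) ∧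
        -- the infinitesimal form, an identity of power series in `g` over `K[ℓ]`
        -mapCoeff Polynomial.derivative (correlation φ S) =
          PowerSeries.map Polynomial.C (physicalAnomalousDim φ S) *
            (correlation φ S + PowerSeries.C (Polynomial.C κ) *
              (PowerSeries.X * PowerSeries.derivative (Polynomial K) (correlation φ S))) ∧
        -mapCoeff Polynomial.derivative (correlation φ S) =
          correlation φ S *
            (PowerSeries.map Polynomial.C (physicalAnomalousDim φ S)).subst
              (PowerSeries.X * genPow (correlation φ S) κ) := by
  refine ⟨fun cres c => existsUnique_liftCocycle _ (isOneCocycle_mellinCocycle cres c),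
    fun κ B hB => ⟨existsUnique_dseMap (map_one _) κ B, fun S hS φ => ⟨fun a b => ⟨?_, ?_, ?_⟩,
      neg_derivative_correlation_eq_mul_add hB hS φ,
      neg_derivative_correlation_eq_mul_subst hB hS φ⟩⟩⟩
  · exact correlationAt_add_eq_convolution φ S a b
  · exact correlationAt_add hB hS φ a b
  · rw [add_comm a b]
    exact correlationAt_add hB hS φ b a
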